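/- Let $\mathcal H$ be a real Hilbert space and let $\mathcal P(\mathcal H)$ be the set of bounded linear self-adjoint operators $P$ on $\mathcal H$ that are positive definite, i.e. $\langle x,Px\rangle\ge\lambda\|x\|^2$ for all $x$ and some $\lambda>0$. Write $\|x\|_P=\sqrt{\langle x,Px\rangle}$ and $\mathrm{dist}_P(x,D)=\inf_{y\in D}\|x-y\|_P$ (with $\mathrm{dist}_P(x,\emptyset)=\infty$). A set-valued operator $F:\mathcal H\to2^{\mathcal H}$ is *metrically subregular* at $\bar x$ for $\bar y$ if $\bar y\in F\bar x$ and there are $\kappa\in[0,\infty)$, neighbourhoods $\mathcal U$ of $\bar x$ and $\mathcal V$ of $\bar y$, and $S'\in\mathcal P(\mathcal H)$ such that $\mathrm{dist}_{S'}(x,F^{-1}\bar y)\le\kappa\,\mathrm{dist}_{S'}(\bar y,Fx\cap\mathcal V)$ for all $x\in\mathcal U$. Let $P,S\in\mathcal P(\mathcal H)$ and $\beta\in[0,4)$. Assume that - $A:\mathcal H\to2^{\mathcal H}$ is maximally monotone; $C:\mathcal H\to\mathcal H$ is $\tfrac1\beta$-cocoercive with respect to $\|\cdot\|_P$, i.e.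 $\langle Cx-Cy,x-y\rangle\ge\tfrac1\beta\|Cx-Cy\|_{P^{-1}}^2$ for all $x,y$ (for $\beta=0$ this means that $C$ is constant); and $\mathrm{zer}(A+C)=\{x:0\in Ax+Cx\}$ is nonempty; - each $M_k:\mathcal H\to\mathcal H$, $k\in\mathbb N$, is (single-valued and) maximally monotone, $1$-strongly monotone with respect to $\|\cdot\|_P$, i.e. $\langle M_kx-M_ky,x-y\rangle\ge\|x-y\|_P^2$ for all $x,y$, and $L_M$-Lipschitz continuous with respect to $\|\cdot\|$, with $L_M$ independent of $k$; - $\theta_k\in[\epsilon_\theta,2-\epsilon_\theta]$ for all $k$, for some $\epsilon_\theta\in(0,1)$; - $A+C$ is metrically subregular at every $z\in\mathrm{zer}(A+C)$ for $0$, and either $\mathcal H$ is finite-dimensional, or at every $z\in\mathrm{zer}(A+C)$ the neighbourhood $\mathcal U$ in this property can be taken to be $\mathcal H$. Let $(x_k)_{k\in\mathbb N}$ and $(\hat x_k)_{k\in\mathbb N}$ be generated from some $x_0\in\mathcal H$ by $$\hat x_k=(M_k+A)^{-1}(M_k-C)x_k,\qquad H_k=\{z:\langle M_kx_k-M_k\hat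 x_k,z-\hat x_k\rangle\le\tfrac\beta4\|x_k-\hat x_k\|_P^2\},\qquad x_{k+1}=(1-\theta_k)x_k+\theta_k\Pi^S_{H_k}(x_k),$$ where $\Pi^S_{H_k}$ is the projection onto $H_k$ in the norm $\|\cdot\|_S$. Then $\mathrm{dist}_S(x_k,\mathrm{zer}(A+C))$ converges locally Q-linearly to $0$: it tends to $0$ and there are $q\in[0,1)$ and $K\in\mathbb N$ with $\mathrm{dist}_S(x_{k+1},\mathrm{zer}(A+C))\le q\,\mathrm{dist}_S(x_k,\mathrm{zer}(A+C))$ for all $k\ge K$. Moreover, $(x_k)$ converges strongly and locally R-linearly to some $\bar x\in\mathrm{zer}(A+C)$: $x_k\to\bar x$ and there are $R\ge0$, $q\in[0,1)$ and $K\in\mathbb N$ with $\|x_k-\bar x\|\le Rq^k$ for all $k\ge K$. -/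

import Mathlib

open Filter Topology
open scoped NNReal ENNReal

noncomputable section

namespace NOFOB

variable {H : Type*} [NormedAddCommGroup H] [InnerProductSpace ℝ H]

/-! ### Operators and metrics -/

/-- The set `𝓟(H)` of bounded linear self-adjoint positive definite operators. Positive
definiteness is uniform: there is `c > 0` (a number `λ_min(P) > 0`) with `c ‖x‖² ≤ ⟨x, P x⟩`. -/
def IsPosDef [CompleteSpace H] (P : H →L[ℝ] H) : Prop :=
  IsSelfAdjoint P ∧ ∃ c : ℝ, 0 < c ∧ ∀ x : H, c * ‖x‖ ^ 2 ≤ inner ℝ x (P x)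

/-- The norm `‖x‖_P = √⟨x, P x⟩`. -/
def pnorm (P : H →L[ℝ] H) (x : H) : ℝ := √(inner ℝ x (P x))

/-- The distance `inf_{y ∈ D} ‖x - y‖_S` as an extended nonnegative number; it is `∞` when
`D` is empty. -/
def edistS (S : H →L[ℝ] H) (x : H) (D : Set H) : ℝ≥0∞ :=
  ⨅ y ∈ D, ENNReal.ofReal (pnorm S (x - y))

/-- The real number `dist_S(x, D) = inf_{y ∈ D} ‖x - y‖_S`, for nonempty `D`. -/
def distS (S : H →L[ℝ] H) (x : H) (D : Set H) : ℝ := (edistS S x D).toReal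

/-- `p` is the projection of `x` onto `D` in the norm `‖·‖_S`, i.e. `p ∈ D` minimizes
`‖x - z‖_S` over `z ∈ D`. -/
def IsProjS (S : H →L[ℝ] H) (D : Set H) (x p : H) : Prop :=
  p ∈ D ∧ ∀ z ∈ D, pnorm S (x - p) ≤ pnorm S (x - z)

/-- A set-valued operator is monotone. -/
def IsMonotoneOp (A : H → Set H) : Prop :=
  ∀ x y u v : H, u ∈ A x → v ∈ A y → 0 ≤ inner ℝ (u - v) (x - y)

/-- A monotone operator is maximally monotone if its graph is not properly contained in the
graph of another monotone operator. -/
def IsMaximallyMonotone (A : H → Set H) : Prop :=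
  IsMonotoneOp A ∧ ∀ B : H → Set H, IsMonotoneOp B → (∀ x, A x ⊆ B x) → ∀ x, B x ⊆ A x

/-- `σ`-strong monotonicity with respect to `‖·‖_P`. -/
def IsStronglyMonotone (σ : ℝ) (P : H →L[ℝ] H) (A : H → Set H) : Prop :=
  0 < σ ∧ ∀ x y u v : H, u ∈ A x → v ∈ A y →
    σ * pnorm P (x - y) ^ 2 ≤ inner ℝ (u - v) (x - y)

/-- `γ`-cocoercivity with respect to `‖·‖_P`. -/
def IsCocoercive (γ : ℝ) (P : H →L[ℝ] H) (T : H → H) : Prop :=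
  0 ≤ γ ∧ ∀ x y : H, γ * pnorm P.inverse (T x - T y) ^ 2 ≤ inner ℝ (T x - T y) (x - y)

/-- `1/β`-cocoercivity with respect to `‖·‖_P` for `β ≥ 0`, with the convention `1/0 = ∞`:
an `∞`-cocoercive operator is a constant one. -/
def IsInvCocoercive (β : ℝ) (P : H →L[ℝ] H) (T : H → H) : Prop :=
  (0 < β ∧ IsCocoercive (1 / β) P T) ∨ (β = 0 ∧ ∀ x y : H, T x = T y)

/-- The single-valued operator `T`, seen as a set-valued one. -/
def single (T : H → H) : H → Set H := fun x => {T x}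

/-- The sum `A + C` of a set-valued and a single-valued operator. -/
def addOp (A : H → Set H) (C : H → H) : H → Set H := fun x => {w | ∃ u ∈ A x, w = u + C x}

/-- The inverse of a set-valued operator. -/
def invOp (F : H → Set H) : H → Set H := fun y => {x | y ∈ F x}

/-- The zeros of a set-valued operator. -/
def zer (F : H → Set H) : Set H := {x | 0 ∈ F x}

/-! ### Metric subregularity -/

/-- `F` is metrically subregular at `xb` for `yb`, with the neighbourhood `U` of `xb`. -/
def IsMetricallySubregularOn [CompleteSpace H] (F : H → Set H) (xb yb : H) (U : Set H) : Prop :=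
  yb ∈ F xb ∧ U ∈ 𝓝 xb ∧ ∃ κ : ℝ≥0, ∃ V ∈ 𝓝 yb, ∃ S : H →L[ℝ] H, IsPosDef S ∧
    ∀ x ∈ U, edistS S x (invOp F yb) ≤ (κ : ℝ≥0∞) * edistS S yb (F x ∩ V)

/-- `F` is metrically subregular at `xb` for `yb`. -/
def IsMetricallySubregular [CompleteSpace H] (F : H → Set H) (xb yb : H) : Prop :=
  ∃ U : Set H, IsMetricallySubregularOn F xb yb U

/-! ### The algorithm -/

/-- The assumptions on the problem `0 ∈ A x + C x`. -/
structure ProblemAssumption [CompleteSpace H] (A : H → Set H) (C : H → H) (β : ℝ)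
    (P : H →L[ℝ] H) : Prop where
  maxMonotone : IsMaximallyMonotone A
  beta_nonneg : 0 ≤ β
  beta_lt : β < 4
  posDef : IsPosDef P
  cocoercive : IsInvCocoercive β P C
  nonempty : (zer (addOp A C)).Nonempty

/-- The assumptions on the kernels `M_k` (with a Lipschitz constant common to all `k`) and
on the projection metric. -/
structure KernelAssumption [CompleteSpace H] (M : ℕ → H → H) (P S : H →L[ℝ] H) : Prop where
  maxMonotone : ∀ k, IsMaximallyMonotone (single (M k))
  stronglyMonotone : ∀ k, IsStronglyMonotone 1 P (single (M k))
  lipschitz : ∃ L : ℝ≥0, ∀ k, LipschitzWith L (M k)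
  posDef : IsPosDef S

/-- The halfspace `{z : ⟨M x - M x̂, z - x̂⟩ ≤ (β/4) ‖x - x̂‖_P²}`. -/
def halfspace (M : H → H) (β : ℝ) (P : H →L[ℝ] H) (x xh : H) : Set H :=
  {z | inner ℝ (M x - M xh) (z - xh) ≤ β / 4 * pnorm P (x - xh) ^ 2}

/-- `(x_k)`, `(x̂_k)` are sequences generated by nonlinear forward-backward splitting:
`x̂_k = (M_k + A)⁻¹ (M_k - C) x_k` and `x_{k+1} = (1 - θ_k) x_k + θ_k Π_{H_k}^S(x_k)`. -/
structure IsNOFOB (A : H → Set H) (C : H → H) (β : ℝ) (P S : H →L[ℝ] H) (M : ℕ → H → H)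
    (θ : ℕ → ℝ) (x xh : ℕ → H) : Prop where
  forwardBackward : ∀ k, xh k ∈ invOp (addOp A (M k)) (M k (x k) - C (x k))
  update : ∀ k, ∃ p : H, IsProjS S (halfspace (M k) β P (x k) (xh k)) (x k) p ∧
    x (k + 1) = (1 - θ k) • x k + θ k • p

/-! ### Rates -/

/-- A real sequence converges locally (i.e. from some index on) Q-linearly to `l`. -/
def LocallyQLinear (a : ℕ → ℝ) (l : ℝ) : Prop :=
  Tendsto a atTop (𝓝 l) ∧
    ∃ q : ℝ, 0 ≤ q ∧ q < 1 ∧ ∃ K : ℕ, ∀ k ≥ K, |a (k + 1) - l| ≤ q * |a k - l|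

/-- A sequence in `H` converges strongly, and locally (i.e. from some index on) R-linearly,
to `xb`. -/
def LocallyRLinear (x : ℕ → H) (xb : H) : Prop :=
  Tendsto x atTop (𝓝 xb) ∧
    ∃ R q : ℝ, 0 ≤ R ∧ 0 ≤ q ∧ q < 1 ∧ ∃ K : ℕ, ∀ k ≥ K, ‖x k - xb‖ ≤ R * q ^ k

end NOFOB

end

/-!
The proof rests on one decrease inequality and one error bound. Write `Z` for the set of zeros of
`A + C` and `d k` for the distance of `x k` to `Z` in `‖·‖_S`.

* *Decrease.* Monotonicity of `A` and cocoercivity of `C` show that the halfspace `H_k` contains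
  `Z` (`zer_subset_halfspace`). A relaxed projection onto a convex set containing `z` satisfies
  `‖x (k+1) - z‖_S² + (ε/2) ‖x (k+1) - x k‖_S² ≤ ‖x k - z‖_S²`
  (`IsProjS.pnorm_relaxed_sq_add_le`), and taking the infimum over `z ∈ Z` gives the same
  inequality for `d`. No projection onto `Z` is needed.
* *Error bound.* Since `β < 4`, the point `x k` lies so far outside of `H_k` that
  `‖x k - x̂ k‖` is at most a constant times `‖x (k+1) - x k‖_S` (`exists_mul_norm_le_pnorm_step`).
  In particular `x k - x̂ k → 0` (`tendsto_residual`). The step also yields an element of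
  `(A + C) (x̂ k)` of norm `O(‖x k - x̂ k‖)`, so metric subregularity bounds `d k` by a multiple of
  `‖x k - x̂ k‖` for large `k` (`IsMetricallySubregularOn.exists_distS_le`), provided that `x̂ k`
  is eventually in the neighborhood `U`. This is clear if `U` is the whole space; in finite
  dimension it holds because Fejér monotonicity and the closed graph of `A` make `x`
  converge to a zero (`exists_tendsto_of_fejer`), at which the subregularity is then used.

Together, `d (k+1)² ≤ d k² - η d k²` with `η > 0`, which is Q-linear convergence of `d`. As the step
lengths are `O(d k)`, the sequence `x` is Cauchy with geometric tails (`linear_rates_of_fejer`), and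
its limit is a zero since the graph of `A` is closed.
-/

namespace NOFOB

variable {H : Type*} [NormedAddCommGroup H] [InnerProductSpace ℝ H]

/-! ### Positive definite operators and their norms -/

lemma pnorm_nonneg (P : H →L[ℝ] H) (x : H) : 0 ≤ pnorm P x := Real.sqrt_nonneg _

lemma pnorm_neg (P : H →L[ℝ] H) (x : H) : pnorm P (-x) = pnorm P x := by
  simp [pnorm]

lemma exists_pnorm_le (P : H →L[ℝ] H) : ∃ a : ℝ, 0 < a ∧ ∀ x, pnorm P x ≤ a * ‖x‖ := by
  refine ⟨‖P‖ + 1, by positivity, fun x => Real.sqrt_le_iff.2 ⟨by positivity, ?_⟩⟩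
  calc inner ℝ x (P x) ≤ ‖x‖ * ‖P x‖ := real_inner_le_norm _ _
    _ ≤ ‖x‖ * (‖P‖ * ‖x‖) := by gcongr; exact P.le_opNorm x
    _ = ‖P‖ * ‖x‖ ^ 2 := by ring
    _ ≤ (‖P‖ + 1) ^ 2 * ‖x‖ ^ 2 := by gcongr; nlinarith [norm_nonneg P]
    _ = ((‖P‖ + 1) * ‖x‖) ^ 2 := by ring

section PosDef

variable [CompleteSpace H] {P : H →L[ℝ] H}

lemma IsPosDef.inner_nonneg (hP : IsPosDef P) (x : H) : 0 ≤ inner ℝ x (P x) := by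
  obtain ⟨c, hc, h⟩ := hP.2
  exact le_trans (by positivity) (h x)

lemma IsPosDef.pnorm_sq (hP : IsPosDef P) (x : H) : pnorm P x ^ 2 = inner ℝ x (P x) :=
  Real.sq_sqrt (hP.inner_nonneg x)

lemma IsPosDef.inner_comm (hP : IsPosDef P) (x y : H) :
    inner ℝ x (P y) = inner ℝ y (P x) := by
  rw [← ContinuousLinearMap.adjoint_inner_left, hP.1.adjoint_eq, real_inner_comm]

lemma IsPosDef.exists_le_pnorm (hP : IsPosDef P) :
    ∃ c : ℝ, 0 < c ∧ ∀ x, c * ‖x‖ ≤ pnorm P x := by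
  obtain ⟨c, hc, h⟩ := hP.2
  refine ⟨√c, Real.sqrt_pos.2 hc, fun x => Real.le_sqrt_of_sq_le ?_⟩
  rw [mul_pow, Real.sq_sqrt hc.le]
  exact h x

/-- Expansion of the square of `‖x + t y‖_P`. -/
lemma IsPosDef.pnorm_add_smul_sq (hP : IsPosDef P) (x y : H) (t : ℝ) :
    pnorm P (x + t • y) ^ 2 =
      pnorm P x ^ 2 + 2 * t * inner ℝ x (P y) + t ^ 2 * pnorm P y ^ 2 := by
  simp only [hP.pnorm_sq, map_add, map_smul, inner_add_left, inner_add_right,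
    real_inner_smul_left, real_inner_smul_right, hP.inner_comm y x]
  ring

lemma IsPosDef.pnorm_smul_sq (hP : IsPosDef P) (t : ℝ) (y : H) :
    pnorm P (t • y) ^ 2 = t ^ 2 * pnorm P y ^ 2 := by
  simp only [hP.pnorm_sq, map_smul, real_inner_smul_left, real_inner_smul_right]
  ring

lemma IsPosDef.isInvertible (hP : IsPosDef P) : P.IsInvertible := by
  obtain ⟨c, hc, h⟩ := hP.2
  have hu : IsUnit P := by
    refine ContinuousLinearMap.isUnit_of_forall_le_norm_inner_map P (c := ⟨c, hc.le⟩) hc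
      fun x => ?_
    rw [real_inner_comm]
    calc ‖x‖ ^ 2 * c = c * ‖x‖ ^ 2 := mul_comm _ _
      _ ≤ _ := (h x).trans (le_abs_self _)
  obtain ⟨e, he⟩ := hu
  exact ⟨ContinuousLinearEquiv.unitsEquiv ℝ H e, by rw [← he]; rfl⟩

/-- The `P⁻¹`-norm of `P u` is the `P`-norm of `u`. -/
lemma IsPosDef.pnorm_inverse_apply (hP : IsPosDef P) (u : H) :
    pnorm P.inverse (P u) = pnorm P u := by
  have h : P.inverse (P u) = u := (hP.isInvertible.inverse_apply_eq).2 rfl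
  rw [pnorm, h, real_inner_comm, pnorm]

end PosDef

/-! ### Distances to a nonempty set -/

lemma distS_nonneg (S : H →L[ℝ] H) (x : H) (D : Set H) : 0 ≤ distS S x D :=
  ENNReal.toReal_nonneg

lemma edistS_ne_top (S : H →L[ℝ] H) (x : H) {D : Set H} (hD : D.Nonempty) :
    edistS S x D ≠ ∞ := by
  obtain ⟨y, hy⟩ := hD
  exact ne_top_of_le_ne_top ENNReal.ofReal_ne_top (iInf₂_le y hy)

lemma edistS_le (S : H →L[ℝ] H) (x : H) {D : Set H} {y : H} (hy : y ∈ D) :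
    edistS S x D ≤ ENNReal.ofReal (pnorm S (x - y)) := iInf₂_le y hy

lemma distS_le (S : H →L[ℝ] H) (x : H) {D : Set H} {y : H} (hy : y ∈ D) :
    distS S x D ≤ pnorm S (x - y) :=
  ENNReal.toReal_le_of_le_ofReal (pnorm_nonneg _ _) (edistS_le S x hy)

lemma le_distS (S : H →L[ℝ] H) (x : H) {D : Set H} (hD : D.Nonempty) {a : ℝ}
    (h : ∀ y ∈ D, a ≤ pnorm S (x - y)) : a ≤ distS S x D :=
  (ENNReal.ofReal_le_iff_le_toReal (edistS_ne_top S x hD)).1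
    (le_iInf₂ fun y hy => ENNReal.ofReal_le_ofReal (h y hy))

/-- Change of base point and of metric in the distance to a set. -/
lemma exists_distS_le [CompleteSpace H] (S : H →L[ℝ] H) {S' : H →L[ℝ] H} (hS' : IsPosDef S') :
    ∃ a : ℝ, 0 < a ∧ ∀ (D : Set H), D.Nonempty → ∀ x y : H,
      distS S x D ≤ a * (‖x - y‖ + distS S' y D) := by
  obtain ⟨a, ha, hSa⟩ := exists_pnorm_le S
  obtain ⟨c, hc, hSc⟩ := hS'.exists_le_pnorm
  refine ⟨a * (1 + 1 / c), by positivity, fun D hD x y => ?_⟩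
  have key : (distS S x D / a - ‖x - y‖) * c ≤ distS S' y D := by
    refine le_distS S' y hD fun z hz => le_trans ?_ (hSc _)
    rw [mul_comm]
    gcongr
    rw [sub_le_iff_le_add, div_le_iff₀ ha]
    calc distS S x D ≤ a * ‖x - z‖ := (distS_le S x hz).trans (hSa _)
      _ ≤ a * (‖x - y‖ + ‖y - z‖) := by gcongr; exact norm_sub_le_norm_sub_add_norm_sub _ _ _
      _ = _ := by ring
  rw [← le_div_iff₀ hc, sub_le_iff_le_add, div_le_iff₀ ha] at key
  have h1 : 0 ≤ ‖x - y‖ / c := by positivity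
  have h2 : 0 ≤ distS S' y D := distS_nonneg _ _ _
  calc distS S x D ≤ (distS S' y D / c + ‖x - y‖) * a := key
    _ ≤ (distS S' y D / c + ‖x - y‖ + (‖x - y‖ / c + distS S' y D)) * a := 
        mul_le_mul_of_nonneg_right (le_add_of_nonneg_right (add_nonneg h1 h2)) ha.le
    _ = _ := by ring

/-! ### Monotone operators and zeros -/

/-- The graph of a maximally monotone operator is closed under limits. -/
lemma IsMaximallyMonotone.mem_of_tendsto {A : H → Set H} (hA : IsMaximallyMonotone A)
    {ι : Type*} {l : Filter ι} [l.NeBot] {x u : ι → H} {xb ub : H}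
    (hx : Tendsto x l (𝓝 xb)) (hu : Tendsto u l (𝓝 ub)) (h : ∀ i, u i ∈ A (x i)) :
    ub ∈ A xb := by
  have rel : ∀ y v, v ∈ A y → 0 ≤ inner ℝ (ub - v) (xb - y) := fun y v hv =>
    ge_of_tendsto ((hu.sub_const v).inner (hx.sub_const y))
      (Eventually.of_forall fun i => hA.1 _ _ _ _ (h i) hv)
  -- `(xb, ub)` is monotonically related to the graph, so it can be added to it.
  refine hA.2 (fun y => A y ∪ {v | y = xb ∧ v = ub}) ?_ (fun y => Set.subset_union_left) xb
    (Or.inr ⟨rfl, rfl⟩)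
  rintro y z v w (hv | ⟨rfl, rfl⟩) (hw | ⟨rfl, rfl⟩)
  · exact hA.1 _ _ _ _ hv hw
  · rw [← neg_sub z y, ← neg_sub w v, inner_neg_neg]
    exact rel _ _ hv
  · exact rel _ _ hw
  · simp

lemma IsMaximallyMonotone.mem_zer_addOp_of_tendsto {A : H → Set H} (hA : IsMaximallyMonotone A)
    {C : H → H} (hC : Continuous C) {ι : Type*} {l : Filter ι} [l.NeBot] {x w : ι → H} {xb : H}
    (hx : Tendsto x l (𝓝 xb)) (hw : Tendsto w l (𝓝 0)) (h : ∀ i, w i ∈ addOp A C (x i)) :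
    xb ∈ zer (addOp A C) := by
  choose u hu hwu using h
  refine ⟨-C xb, hA.mem_of_tendsto hx ?_ hu, by simp⟩
  have : u = fun i => w i - C (x i) := by funext i; rw [hwu i, add_sub_cancel_right]
  rw [this, ← zero_sub]
  exact hw.sub ((hC.tendsto xb).comp hx)

section Cocoercive

variable [CompleteSpace H] {P : H →L[ℝ] H} {β : ℝ} {C : H → H}

/-- Cocoercivity with `C x - C y` written as `P u`, which removes the inverse of `P` and covers
the constant operators of the case `β = 0` by `u = 0`. -/
lemma IsInvCocoercive.exists_apply_eq (hP : IsPosDef P) (hC : IsInvCocoercive β P C) (x y : H) :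
    ∃ u : H, P u = C x - C y ∧ pnorm P u ^ 2 ≤ β * inner ℝ (P u) (x - y) := by
  rcases hC with ⟨hβ, -, h⟩ | ⟨rfl, h⟩
  · refine ⟨P.inverse (C x - C y), hP.isInvertible.self_apply_inverse _, ?_⟩
    have h1 := h x y
    have h2 : P (P.inverse (C x - C y)) = C x - C y := hP.isInvertible.self_apply_inverse _
    have h3 := hP.pnorm_inverse_apply (P.inverse (C x - C y))
    rw [h2] at h3
    rw [h3, one_div, inv_mul_le_iff₀ hβ] at h1
    rwa [h2]
  · exact ⟨0, by simp [h x y], by simp [pnorm]⟩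

lemma IsInvCocoercive.exists_lipschitzWith (hP : IsPosDef P) (hβ : 0 ≤ β)
    (hC : IsInvCocoercive β P C) : ∃ L : ℝ≥0, LipschitzWith L C := by
  obtain ⟨c, hc, h⟩ := hP.2
  refine ⟨Real.toNNReal (‖P‖ * (β * ‖P‖ / c)), LipschitzWith.of_dist_le' fun x y => ?_⟩
  rw [dist_eq_norm, dist_eq_norm]
  obtain ⟨u, hu, hle⟩ := hC.exists_apply_eq hP x y
  have hun : ‖u‖ ≤ β * ‖P‖ / c * ‖x - y‖ := by
    rcases (norm_nonneg u).eq_or_lt with h0 | h0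
    · rw [← h0]; positivity
    have : c * ‖u‖ ^ 2 ≤ β * (‖P‖ * ‖u‖ * ‖x - y‖) := by
      calc c * ‖u‖ ^ 2 ≤ pnorm P u ^ 2 := by rw [hP.pnorm_sq]; exact h u
        _ ≤ β * inner ℝ (P u) (x - y) := hle
        _ ≤ β * (‖P u‖ * ‖x - y‖) := by gcongr; exact real_inner_le_norm _ _
        _ ≤ _ := by gcongr; exact P.le_opNorm u
    rw [div_mul_eq_mul_div, le_div_iff₀ hc]
    refine le_of_mul_le_mul_right ?_ h0
    linarith
  rw [← hu, mul_assoc]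
  exact (P.le_opNorm u).trans (by gcongr)

/-- A three-point inequality for cocoercive operators, from completing a square in `‖·‖_P`. -/
lemma IsInvCocoercive.neg_le_inner (hP : IsPosDef P) (hβ : 0 ≤ β) (hC : IsInvCocoercive β P C)
    (x y z : H) : -(β / 4 * pnorm P (x - y) ^ 2) ≤ inner ℝ (C x - C z) (y - z) := by
  obtain ⟨u, hu, hle⟩ := hC.exists_apply_eq hP x z
  have hsplit : inner ℝ (C x - C z) (y - z) = inner ℝ (P u) (x - z) - inner ℝ (x - y) (P u) := by
    rw [← hu, real_inner_comm (P u) (x - y), ← inner_sub_right]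
    congr 1; abel
  have hsq := sq_nonneg (pnorm P (u + (-(β / 2)) • (x - y)))
  rw [hP.pnorm_add_smul_sq, hP.inner_comm u] at hsq
  rw [hsplit]
  rcases hβ.eq_or_lt with rfl | hβ'
  · have h0 : pnorm P u ^ 2 = 0 := le_antisymm (by simpa using hle) (sq_nonneg _)
    obtain ⟨c, hc, h⟩ := hP.exists_le_pnorm
    have hu0 : u = 0 := by
      have := h u
      rw [pow_eq_zero_iff two_ne_zero] at h0
      rw [h0] at this
      exact norm_le_zero_iff.1 (by nlinarith [norm_nonneg u])
    simp [hu0]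
  · refine le_of_mul_le_mul_left ?_ hβ'
    nlinarith

end Cocoercive

/-! ### One step of the algorithm -/

lemma convex_halfspace (T : H → H) (β : ℝ) (P : H →L[ℝ] H) (x xh : H) :
    Convex ℝ (halfspace T β P x xh) := by
  have : halfspace T β P x xh = {z | innerSL ℝ (T x - T xh) z ≤
      β / 4 * pnorm P (x - xh) ^ 2 + inner ℝ (T x - T xh) xh} := by
    ext z
    simp only [halfspace, Set.mem_ofPred_eq, inner_sub_right, innerSL_apply_apply,
      sub_le_iff_le_add]
  rw [this]
  exact convex_halfSpace_le (innerSL ℝ (T x - T xh)).toLinearMap.isLinear _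

section Step

variable [CompleteSpace H] {A : H → Set H} {C T : H → H} {β : ℝ} {P S : H →L[ℝ] H}

/-- The halfspace built from a forward-backward step contains every zero of `A + C`. -/
lemma zer_subset_halfspace (hA : IsMonotoneOp A) (hP : IsPosDef P) (hβ : 0 ≤ β)
    (hC : IsInvCocoercive β P C) {x xh : H} (hxh : xh ∈ invOp (addOp A T) (T x - C x)) :
    zer (addOp A C) ⊆ halfspace T β P x xh := by
  rintro z ⟨v, hv, hvz⟩
  obtain ⟨u, hu, hux⟩ := hxh
  have hmono := hA _ _ _ _ hu hv
  have h3 := hC.neg_le_inner hP hβ x xh z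
  have hv' : v = -C z := eq_neg_of_add_eq_zero_left hvz.symm
  have hu' : u = T x - T xh - C x := by rw [eq_sub_iff_add_eq.2 hux.symm]; abel
  have e : u - v = (T x - T xh) - (C x - C z) := by rw [hu', hv']; abel
  rw [e, inner_sub_left] at hmono
  change inner ℝ (T x - T xh) (z - xh) ≤ _
  rw [← neg_sub xh z, inner_neg_right]
  linarith

/-- The variational inequality that characterizes projections onto convex sets. -/
lemma IsProjS.inner_le_zero (hS : IsPosDef S) {D : Set H} (hD : Convex ℝ D) {x p : H}
    (hp : IsProjS S D x p) {z : H} (hz : z ∈ D) : inner ℝ (x - p) (S (z - p)) ≤ 0 := by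
  by_contra! hpos
  set b := inner ℝ (x - p) (S (z - p)) with hb
  set m := pnorm S (z - p) ^ 2 with hm
  have hm0 : 0 ≤ m := sq_nonneg _
  -- Moving from `p` towards `z` by a short step `t` would decrease the distance to `x`.
  have key : ∀ t : ℝ, 0 < t → t ≤ 1 → 2 * b ≤ t * m := by
    intro t ht ht1
    have hmem : p + t • (z - p) ∈ D := hD.add_smul_sub_mem hp.1 hz ⟨ht.le, ht1⟩
    have h1 := pow_le_pow_left₀ (pnorm_nonneg _ _) (hp.2 _ hmem) 2
    have e : x - (p + t • (z - p)) = (x - p) + (-t) • (z - p) := by rw [neg_smul]; abel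
    rw [e, hS.pnorm_add_smul_sq, ← hb, ← hm] at h1
    refine le_of_mul_le_mul_left ?_ ht
    linarith
  have h2 := key (b / (b + m)) (by positivity) ((div_le_one (by positivity)).2 (by linarith))
  have h3 : b / (b + m) * m ≤ b := by
    rw [div_mul_eq_mul_div, div_le_iff₀ (by positivity)]
    nlinarith
  linarith

/-- A relaxed projection step is Fejér monotone, with a decrease proportional to the square of
the step length. -/
lemma IsProjS.pnorm_relaxed_sq_add_le (hS : IsPosDef S) {D : Set H} (hD : Convex ℝ D) {x p x' : H}
    (hp : IsProjS S D x p) {θ ε : ℝ} (hε : 0 < ε) (hθ : ε ≤ θ) (hθ' : θ ≤ 2 - ε)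
    (hx' : x' = (1 - θ) • x + θ • p) {z : H} (hz : z ∈ D) :
    pnorm S (x' - z) ^ 2 + ε / 2 * pnorm S (x' - x) ^ 2 ≤ pnorm S (x - z) ^ 2 := by
  have hv := hp.inner_le_zero hS hD hz
  have e1 : x' - z = (x - z) + (-θ) • (x - p) := by
    rw [hx']; module
  have e2 : x' - x = (-θ) • (x - p) := by rw [hx']; module
  have e3 : z - p = (x - p) - (x - z) := by abel
  rw [e3, map_sub, inner_sub_right, ← hS.pnorm_sq, hS.inner_comm (x - p) (x - z)] at hv
  rw [e1, e2, hS.pnorm_add_smul_sq, hS.pnorm_smul_sq]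
  have hq : 0 ≤ pnorm S (x - p) ^ 2 := sq_nonneg _
  set q := pnorm S (x - p) ^ 2
  have h4 : θ * q ≤ θ * inner ℝ (x - z) (S (x - p)) := by
    apply mul_le_mul_of_nonneg_left _ (by linarith); linarith
  have h5 : 0 ≤ θ * q * (2 - θ - ε / 2 * θ) := by
    apply mul_nonneg (mul_nonneg (by linarith) hq); nlinarith
  nlinarith

/-- The step length dominates the residual `x - x̂`, since `x` violates the inequality defining
the halfspace by at least `(1 - β/4) ‖x - x̂‖_P²`. -/
lemma exists_mul_norm_le_pnorm_step (hβ : β < 4) (hP : IsPosDef P) (hS : IsPosDef S) (L : ℝ≥0)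
    {ε : ℝ} (hε : 0 < ε) :
    ∃ γ : ℝ, 0 < γ ∧ ∀ (T : H → H), LipschitzWith L T → IsStronglyMonotone 1 P (single T) →
      ∀ (x xh p x' : H) (θ : ℝ), ε ≤ θ → p ∈ halfspace T β P x xh →
        x' = (1 - θ) • x + θ • p → γ * ‖x - xh‖ ≤ pnorm S (x' - x) := by
  obtain ⟨c, hc, hcP⟩ := hP.2
  obtain ⟨s, hs, hsS⟩ := hS.exists_le_pnorm
  have hβ' : 0 < 1 - β / 4 := by linarith
  refine ⟨s * ε * ((1 - β / 4) * c / (L + 1)), by positivity, ?_⟩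
  intro T hT hmono x xh p x' θ hθ hp hx'
  have h1 := hmono.2 x xh (T x) (T xh) rfl rfl
  have hp' : inner ℝ (T x - T xh) (p - xh) ≤ β / 4 * pnorm P (x - xh) ^ 2 := hp
  have e : inner ℝ (T x - T xh) (x - p) =
      inner ℝ (T x - T xh) (x - xh) - inner ℝ (T x - T xh) (p - xh) := by
    rw [← inner_sub_right]; congr 1; abel
  have h2 : (1 - β / 4) * (c * ‖x - xh‖ ^ 2) ≤ (L + 1) * ‖x - xh‖ * ‖x - p‖ := by
    calc (1 - β / 4) * (c * ‖x - xh‖ ^ 2) ≤ (1 - β / 4) * pnorm P (x - xh) ^ 2 := by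
          gcongr; rw [hP.pnorm_sq]; exact hcP _
      _ ≤ inner ℝ (T x - T xh) (x - p) := by linarith
      _ ≤ ‖T x - T xh‖ * ‖x - p‖ := real_inner_le_norm _ _
      _ ≤ (L + 1) * ‖x - xh‖ * ‖x - p‖ := by
          gcongr
          exact (hT.norm_sub_le x xh).trans (by gcongr; linarith)
  have h3 : (1 - β / 4) * c / (L + 1) * ‖x - xh‖ ≤ ‖x - p‖ := by
    rw [div_mul_eq_mul_div, div_le_iff₀ (by positivity)]
    rcases (norm_nonneg (x - xh)).eq_or_lt with h0 | h0
    · rw [← h0, mul_zero]; positivity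
    · refine le_of_mul_le_mul_right ?_ h0
      linarith
  have e2 : x' - x = (-θ) • (x - p) := by rw [hx']; module
  calc s * ε * ((1 - β / 4) * c / (L + 1)) * ‖x - xh‖
      = s * (ε * ((1 - β / 4) * c / (L + 1) * ‖x - xh‖)) := by ring
    _ ≤ s * (θ * ‖x - p‖) := by
        gcongr
        exact hε.le.trans hθ
    _ = s * ‖x' - x‖ := by
        rw [e2, norm_smul, norm_neg, Real.norm_of_nonneg (hε.le.trans hθ)]
    _ ≤ _ := hsS _

end Step

/-! ### Asymptotics of Fejér monotone sequences -/

section Asymptotics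

variable {S : H →L[ℝ] H} {Z : Set H} {x xh : ℕ → H} {δ γ κ : ℝ}

lemma tendsto_residual (hδ : 0 < δ) (hγ : 0 < γ) {z : H}
    (hF : ∀ k, pnorm S (x (k + 1) - z) ^ 2 + δ * pnorm S (x (k + 1) - x k) ^ 2 ≤
      pnorm S (x k - z) ^ 2)
    (hG : ∀ k, γ * ‖x k - xh k‖ ≤ pnorm S (x (k + 1) - x k)) :
    Tendsto (fun k => x k - xh k) atTop (𝓝 0) := by
  have hanti : Antitone fun k => pnorm S (x k - z) ^ 2 := antitone_nat_of_succ_le fun k =>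
    le_trans (le_add_of_nonneg_right (by positivity)) (hF k)
  have hlim := tendsto_atTop_ciInf hanti ⟨0, by rintro _ ⟨k, rfl⟩; positivity⟩
  have hdiff := (hlim.sub (hlim.comp (tendsto_add_atTop_nat 1))).div_const (δ * γ ^ 2)
  rw [sub_self, zero_div] at hdiff
  have hsq : Tendsto (fun k => ‖x k - xh k‖ ^ 2) atTop (𝓝 0) := by
    refine squeeze_zero (fun k => sq_nonneg _) (fun k => ?_) hdiff
    have h1 := pow_le_pow_left₀ (by positivity) (hG k) 2
    rw [mul_pow] at h1
    have h2 := mul_le_mul_of_nonneg_left h1 hδ.le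
    rw [le_div_iff₀ (by positivity)]
    have h3 := hF k
    simp only [Function.comp]
    linarith
  rw [tendsto_zero_iff_norm_tendsto_zero]
  have := hsq.sqrt
  simpa [Real.sqrt_sq (norm_nonneg _)] using this

/-- In finite dimension a Fejér monotone sequence whose cluster points lie in the target set
converges to a point of that set. -/
lemma exists_tendsto_of_fejer [FiniteDimensional ℝ H] [CompleteSpace H] (hS : IsPosDef S)
    (hZ : Z.Nonempty) (hanti : ∀ z ∈ Z, Antitone fun k => pnorm S (x k - z))
    (hcluster : ∀ (xb : H) (φ : ℕ → ℕ), StrictMono φ → Tendsto (x ∘ φ) atTop (𝓝 xb) → xb ∈ Z) :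
    ∃ xb ∈ Z, Tendsto x atTop (𝓝 xb) := by
  obtain ⟨c, hc, hcS⟩ := hS.exists_le_pnorm
  obtain ⟨a, -, haS⟩ := exists_pnorm_le S
  obtain ⟨z, hz⟩ := hZ
  have hball : ∀ k, x k ∈ Metric.closedBall z (pnorm S (x 0 - z) / c) := fun k => by
    rw [Metric.mem_closedBall, dist_eq_norm, le_div_iff₀ hc, mul_comm]
    exact (hcS _).trans (hanti z hz (Nat.zero_le k))
  obtain ⟨xb, -, φ, hφ, hlim⟩ := (isCompact_closedBall z _).tendsto_subseq hball
  have hxb := hcluster xb φ hφ hlim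
  refine ⟨xb, hxb, ?_⟩
  have hsub : Tendsto ((fun k => pnorm S (x k - xb)) ∘ φ) atTop (𝓝 0) := by
    refine squeeze_zero (fun _ => pnorm_nonneg _ _) (fun k => haS _) ?_
    simpa using (tendsto_iff_norm_sub_tendsto_zero.1 hlim).const_mul a
  have hall := (tendsto_iff_tendsto_subseq_of_antitone (hanti xb hxb) hφ.tendsto_atTop).2 hsub
  rw [tendsto_iff_norm_sub_tendsto_zero]
  refine squeeze_zero (fun _ => norm_nonneg _) (fun k => ?_) (by simpa using hall.div_const c)
  rw [le_div_iff₀ hc, mul_comm]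
  exact hcS _

/-- A Fejér monotone sequence whose steps dominate the distance to the target set approaches
this set Q-linearly and converges R-linearly. -/
lemma linear_rates_of_fejer [CompleteSpace H] (hS : IsPosDef S) (hZ : Z.Nonempty) (hδ : 0 < δ)
    (hF : ∀ k, ∀ z ∈ Z, pnorm S (x (k + 1) - z) ^ 2 + δ * pnorm S (x (k + 1) - x k) ^ 2 ≤
      pnorm S (x k - z) ^ 2)
    (hκ : 0 < κ) {K : ℕ} (hE : ∀ k ≥ K, distS S (x k) Z ≤ κ * pnorm S (x (k + 1) - x k)) :
    LocallyQLinear (fun k => distS S (x k) Z) 0 ∧ ∃ xb, LocallyRLinear x xb := by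
  set d : ℕ → ℝ := fun k => distS S (x k) Z with hd
  have hd0 : ∀ k, 0 ≤ d k := fun k => distS_nonneg _ _ _
  have hdF : ∀ k, d (k + 1) ^ 2 + δ * pnorm S (x (k + 1) - x k) ^ 2 ≤ d k ^ 2 := by
    intro k
    rw [← Real.sqrt_le_left (hd0 k)]
    refine le_distS S (x k) hZ fun z hz => (Real.sqrt_le_left (pnorm_nonneg _ _)).2 ?_
    refine le_trans ?_ (hF k z hz)
    gcongr
    exacts [hd0 _, distS_le S _ hz]
  set η := δ / κ ^ 2 with hη
  have hη0 : 0 < η := by positivity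
  set q := √(1 / (1 + η)) with hq
  have hq0 : 0 < q := Real.sqrt_pos.2 (by positivity)
  have hq1 : q < 1 := by
    rw [hq, Real.sqrt_lt' one_pos, div_lt_iff₀ (by positivity)]
    linarith
  have hdq : ∀ k ≥ K, d (k + 1) ≤ q * d k := by
    intro k hk
    have h1 : η * d k ^ 2 ≤ δ * pnorm S (x (k + 1) - x k) ^ 2 := by
      rw [hη, div_mul_eq_mul_div, div_le_iff₀ (by positivity)]
      calc δ * d k ^ 2 ≤ δ * (κ * pnorm S (x (k + 1) - x k)) ^ 2 := by
            gcongr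
            exacts [hd0 _, hE k hk]
        _ = _ := by ring
    have h2 : 0 ≤ δ * pnorm S (x (k + 1) - x k) ^ 2 := by positivity
    have h3 : d (k + 1) ^ 2 ≤ d k ^ 2 := by linarith [hdF k]
    have h4 : d (k + 1) ^ 2 ≤ 1 / (1 + η) * d k ^ 2 := by
      rw [one_div_mul_eq_div, le_div_iff₀ (by positivity)]
      have := mul_le_mul_of_nonneg_left h3 hη0.le
      linarith [hdF k]
    calc d (k + 1) ≤ √(1 / (1 + η) * d k ^ 2) := Real.le_sqrt_of_sq_le h4
      _ = q * d k := by rw [Real.sqrt_mul (by positivity), Real.sqrt_sq (hd0 k)]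
  have hgeo : ∀ n, d (n + K) ≤ d K * q ^ n := by
    intro n
    induction n with
    | zero => simp
    | succ n ih =>
      calc d (n + 1 + K) = d (n + K + 1) := by congr 1; omega
        _ ≤ q * d (n + K) := hdq _ (by omega)
        _ ≤ q * (d K * q ^ n) := by gcongr
        _ = _ := by ring
  have hpow := tendsto_pow_atTop_nhds_zero_of_lt_one hq0.le hq1
  refine ⟨⟨?_, q, hq0.le, hq1, K, fun k hk => ?_⟩, ?_⟩
  · rw [← tendsto_add_atTop_iff_nat K]
    exact squeeze_zero (fun n => hd0 _) hgeo (by simpa using hpow.const_mul (d K))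
  · rw [sub_zero, sub_zero, abs_of_nonneg (hd0 _), abs_of_nonneg (hd0 _)]
    exact hdq k hk
  -- The steps decay like `q ^ n`, so the sequence is Cauchy with a geometric tail bound.
  obtain ⟨c, hc, hcS⟩ := hS.exists_le_pnorm
  set B := d K / (√δ * c) with hB
  have hstep : ∀ n, dist (x (n + K)) (x (n + 1 + K)) ≤ B * q ^ n := by
    intro n
    rw [dist_comm, dist_eq_norm, hB, div_mul_eq_mul_div, le_div_iff₀ (by positivity)]
    have e : n + 1 + K = n + K + 1 := by omega
    rw [e]
    have h1 : √δ * pnorm S (x (n + K + 1) - x (n + K)) ≤ d (n + K) := by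
      refine (pow_le_pow_iff_left₀ (mul_nonneg (Real.sqrt_nonneg _) (pnorm_nonneg _ _)) (hd0 _)
        two_ne_zero).1 ?_
      rw [mul_pow, Real.sq_sqrt hδ.le]
      linarith [hdF (n + K), sq_nonneg (d (n + K + 1))]
    calc ‖x (n + K + 1) - x (n + K)‖ * (√δ * c)
        = √δ * (c * ‖x (n + K + 1) - x (n + K)‖) := by ring
      _ ≤ √δ * pnorm S (x (n + K + 1) - x (n + K)) := by gcongr; exact hcS _
      _ ≤ d (n + K) := h1
      _ ≤ _ := hgeo n
  obtain ⟨xb, hxb⟩ := cauchySeq_tendsto_of_complete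
    (cauchySeq_of_le_geometric q B hq1 (f := fun n => x (n + K)) hstep)
  have hB0 : 0 ≤ B := div_nonneg (hd0 K) (by positivity)
  have h1q : 0 < 1 - q := by linarith
  refine ⟨xb, (tendsto_add_atTop_iff_nat K).1 hxb, B / (1 - q) / q ^ K, q, by positivity, hq0.le,
    hq1, K, fun k hk => ?_⟩
  obtain ⟨n, rfl⟩ := Nat.exists_eq_add_of_le' hk
  have := dist_le_of_le_geometric_of_tendsto q B hq1 hstep hxb n
  rw [dist_eq_norm] at this
  refine this.trans (le_of_eq ?_)
  rw [pow_add]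
  field_simp

end Asymptotics

/-! ### Error bounds -/

section ErrorBound

variable [CompleteSpace H] {F : H → Set H} {xb : H} {U : Set H} {x xh w : ℕ → H} {L : ℝ}

/-- Metric subregularity bounds the distance to the zeros by the residual, as soon as the points
`x̂ k` have entered the neighborhood on which it holds. -/
lemma IsMetricallySubregularOn.exists_distS_le
    (h : IsMetricallySubregularOn F xb 0 U) (S : H →L[ℝ] H)
    (hU : ∀ᶠ k in atTop, xh k ∈ U) (hw : ∀ k, w k ∈ F (xh k)) (hw0 : Tendsto w atTop (𝓝 0))
    (hL : 0 ≤ L) (hwL : ∀ k, ‖w k‖ ≤ L * ‖x k - xh k‖) :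
    ∃ κ : ℝ, 0 < κ ∧ ∀ᶠ k in atTop, distS S (x k) (zer F) ≤ κ * ‖x k - xh k‖ := by
  obtain ⟨hxb, -, κ, V, hV, S', hS', hsub⟩ := h
  obtain ⟨a, ha, hdist⟩ := NOFOB.exists_distS_le S hS'
  obtain ⟨b, hb, hbS⟩ := exists_pnorm_le S'
  refine ⟨a * (1 + κ * (b * L)), by positivity, ?_⟩
  filter_upwards [hU, hw0 hV] with k hk hwV
  have h1 : distS S' (xh k) (zer F) ≤ κ * pnorm S' (0 - w k) := by
    refine ENNReal.toReal_le_of_le_ofReal (mul_nonneg κ.coe_nonneg (pnorm_nonneg _ _)) ?_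
    rw [ENNReal.ofReal_mul κ.coe_nonneg, ENNReal.ofReal_coe_nnreal]
    exact (hsub (xh k) hk).trans (by gcongr; exact edistS_le S' 0 ⟨hw k, hwV⟩)
  calc distS S (x k) (zer F)
      ≤ a * (‖x k - xh k‖ + distS S' (xh k) (zer F)) := hdist _ ⟨xb, hxb⟩ _ _
    _ ≤ a * (‖x k - xh k‖ + κ * (b * (L * ‖x k - xh k‖))) := by
        gcongr
        refine h1.trans ?_
        rw [zero_sub, pnorm_neg]
        gcongr
        exact (hbS _).trans (by gcongr; exact hwL k)
    _ = _ := by ring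

end ErrorBound

end NOFOB

/-! ### Linear convergence -/

theorem theorem5p4 {H : Type*} [NormedAddCommGroup H] [InnerProductSpace ℝ H] [CompleteSpace H]
    (A : H → Set H) (C : H → H) (β : ℝ) (P S : H →L[ℝ] H) (M : ℕ → H → H) (θ : ℕ → ℝ) (ε : ℝ)
    (hprob : NOFOB.ProblemAssumption A C β P)
    (hker : NOFOB.KernelAssumption M P S)
    (hε : 0 < ε ∧ ε < 1)
    (hθ : ∀ k, ε ≤ θ k ∧ θ k ≤ 2 - ε)
    (hsub : ∀ z ∈ NOFOB.zer (NOFOB.addOp A C),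
      NOFOB.IsMetricallySubregular (NOFOB.addOp A C) z 0)
    (hdim : FiniteDimensional ℝ H ∨ ∀ z ∈ NOFOB.zer (NOFOB.addOp A C),
      NOFOB.IsMetricallySubregularOn (NOFOB.addOp A C) z 0 Set.univ)
    (x xh : ℕ → H)
    (hrun : NOFOB.IsNOFOB A C β P S M θ x xh) :
    NOFOB.LocallyQLinear (fun k => NOFOB.distS S (x k) (NOFOB.zer (NOFOB.addOp A C))) 0 ∧
      ∃ xb ∈ NOFOB.zer (NOFOB.addOp A C), NOFOB.LocallyRLinear x xb := by
  obtain ⟨hA, hβ, hβ4, hP, hC, hZ⟩ := hprob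
  obtain ⟨-, hM, ⟨L, hL⟩, hS⟩ := hker
  obtain ⟨hfb, hup⟩ := hrun
  obtain ⟨LC, hLC⟩ := hC.exists_lipschitzWith hP hβ
  have hF : ∀ k, ∀ z ∈ NOFOB.zer (NOFOB.addOp A C),
      NOFOB.pnorm S (x (k + 1) - z) ^ 2 + ε / 2 * NOFOB.pnorm S (x (k + 1) - x k) ^ 2 ≤
        NOFOB.pnorm S (x k - z) ^ 2 := by
    intro k z hz
    obtain ⟨p, hp, hx⟩ := hup k
    exact hp.pnorm_relaxed_sq_add_le hS (NOFOB.convex_halfspace _ _ _ _ _) hε.1 (hθ k).1 (hθ k).2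
      hx (NOFOB.zer_subset_halfspace hA.1 hP hβ hC (hfb k) hz)
  obtain ⟨γ, hγ, hstep⟩ := NOFOB.exists_mul_norm_le_pnorm_step hβ4 hP hS L hε.1
  have hG : ∀ k, γ * ‖x k - xh k‖ ≤ NOFOB.pnorm S (x (k + 1) - x k) := by
    intro k
    obtain ⟨p, hp, hx⟩ := hup k
    exact hstep _ (hL k) (hM k) _ _ _ _ _ (hθ k).1 hp.1 hx
  have hδ : 0 < ε / 2 := half_pos hε.1
  obtain ⟨z₀, hz₀⟩ := hZ
  have hres : Tendsto (fun k => x k - xh k) atTop (𝓝 0) :=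
    NOFOB.tendsto_residual hδ hγ (fun k => hF k z₀ hz₀) hG
  -- The forward-backward step provides this small element of `(A + C) (xh k)`.
  set w : ℕ → H := fun k => M k (x k) - M k (xh k) - (C (x k) - C (xh k)) with hw
  have hwmem : ∀ k, w k ∈ NOFOB.addOp A C (xh k) := by
    intro k
    obtain ⟨u, hu, hux⟩ := hfb k
    refine ⟨u, hu, ?_⟩
    rw [← sub_eq_iff_eq_add] at hux
    simp only [hw, ← hux]
    abel
  have hwL : ∀ k, ‖w k‖ ≤ ((L : ℝ) + LC) * ‖x k - xh k‖ := by
    intro k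
    rw [add_mul]
    exact (norm_sub_le _ _).trans
      (add_le_add ((hL k).norm_sub_le _ _) (hLC.norm_sub_le _ _))
  have hw0 : Tendsto w atTop (𝓝 0) :=
    squeeze_zero_norm hwL (by simpa using hres.norm.const_mul ((L : ℝ) + LC))
  -- Every cluster point of `x` is a zero of `A + C`, by closedness of the graph.
  have hcluster : ∀ (xb : H) (φ : ℕ → ℕ), StrictMono φ → Tendsto (x ∘ φ) atTop (𝓝 xb) →
      xb ∈ NOFOB.zer (NOFOB.addOp A C) := by
    intro xb φ hφ hlim
    have hxh : Tendsto (xh ∘ φ) atTop (𝓝 xb) := by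
      simpa [Function.comp_def] using hlim.sub (hres.comp hφ.tendsto_atTop)
    exact hA.mem_zer_addOp_of_tendsto hLC.continuous hxh (hw0.comp hφ.tendsto_atTop)
      fun n => hwmem (φ n)
  -- The points `xh k` eventually lie in a neighborhood on which metric subregularity holds.
  obtain ⟨z, U, hzU, hU⟩ : ∃ z U, NOFOB.IsMetricallySubregularOn (NOFOB.addOp A C) z 0 U ∧
      ∀ᶠ k in atTop, xh k ∈ U := by
    rcases hdim with hfin | hglob
    · obtain ⟨xb, hxb, hlim⟩ := NOFOB.exists_tendsto_of_fejer hS ⟨z₀, hz₀⟩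
        (fun z hz => antitone_nat_of_succ_le fun k =>
          (pow_le_pow_iff_left₀ (NOFOB.pnorm_nonneg _ _) (NOFOB.pnorm_nonneg _ _)
            two_ne_zero).1 (le_trans (le_add_of_nonneg_right (by positivity)) (hF k z hz)))
        hcluster
      obtain ⟨U, hU⟩ := hsub xb hxb
      have hxh : Tendsto xh atTop (𝓝 xb) := by simpa using hlim.sub hres
      exact ⟨xb, U, hU, hxh hU.2.1⟩
    · exact ⟨z₀, Set.univ, hglob z₀ hz₀, by simp⟩
  obtain ⟨κ, hκ, hE⟩ := hzU.exists_distS_le S hU hwmem hw0 (by positivity) hwL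
  obtain ⟨K, hK⟩ := eventually_atTop.1 hE
  have hE' : ∀ k ≥ K, NOFOB.distS S (x k) (NOFOB.zer (NOFOB.addOp A C)) ≤
      κ / γ * NOFOB.pnorm S (x (k + 1) - x k) := by
    intro k hk
    refine (hK k hk).trans ?_
    rw [div_mul_eq_mul_div, le_div_iff₀ hγ, mul_assoc, mul_comm _ γ]
    exact mul_le_mul_of_nonneg_left (hG k) hκ.le
  obtain ⟨hQ, xb, hR⟩ :=
    NOFOB.linear_rates_of_fejer hS ⟨z₀, hz₀⟩ hδ hF (div_pos hκ hγ) hE'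
  exact ⟨hQ, xb, hcluster xb id strictMono_id hR.1, hR⟩
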